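/- **Setting (asynchronous multiplayer bandit).** There are $K$ arms, $M$ players, an activation probability $p\in(0,1)$ and a variance $\sigma^2>0$; an instance is a vector of means $\mu\in[0,1]^K$. An assignment is a vector $m\in\{0,\dots,M\}^K$ with $\sum_k m_k=M$ and $m_k\le -1/\log(1-p)$ for all $k$. In each round an algorithm chooses a (possibly random) assignment $m$ depending on the past assignments and feedback (and possibly on the horizon $T$); each player is then active independently with probability $p$, and for every arm $k$ the algorithm observes $\eta_k=\mathbf 1\{\text{exactly one of the } m_k \text{ players of arm } k \text{ is active}\}$ and the earned reward $\eta_kX_k$, where $X_k\sim\mathcal N(\mu_k,\sigma^2)$ independently over arms and rounds and independently of the activations. Let $\eta_k(m_k)$ denote the indicator under $m$ and let $M^*$ be the maximizer of $\mathbb E[\sum_k\eta_k(m_k)X_k]$ over assignments $m$. If $M^*$ is unique, let $\nu^*=|\{k: M^*_k=0\}|$ and write $\mu_{(1)}\le\dots\le\mu_{(K)}$ for the sorted means. The expected regret of an algorithm $A$ playing assignments $M(1),\dots,M(T)$ is $$\mathbb E[R_A(T)]=\sum_{t=1}^T\sum_{k=1}^K\Big(\mathbb E[\eta_k(M^*_k)X_k]-\mathbb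 E[\eta_k(M_k(t))X_k]\Big).$$ Let $T_j$ be the number of rounds among the first $T$ with at least one player on the $j$-th worst arm. The algorithm is *consistent* if for every $\mu\in[0,1]^K$ with a unique optimal assignment and every $\alpha>0$, as $T\to\infty$, $\mathbb E[T_j]=O(T^\alpha)$ for all $j\le\nu^*$ and $\mathbb E[T-T_j]=O(T^\alpha)$ for all $j>\nu^*$. **Lemma (lower bound for $\nu^*>0$).** There is a universal constant $c>0$ such that the following holds. Let $\sigma^2>0$, let $M\ge5$ and $\nu^*\ge1$ be integers, let $0<p\le\frac1{M+1}$, and let $\Delta_{(1)}\ge\dots\ge\Delta_{(\nu^*)}>0$ be gaps with $\Delta_{(\nu)}\le\frac{p}{8(M-4)}$ for all $\nu$. Then for every consistent algorithm $A$ for $M$ players and $K=\nu^*+2$ arms there is $\mu\in[0,1]^{\nu^*+2}$ with a unique optimal assignment, which leaves exactly $\nu^*$ arms without players, such that $\mu_{(\nu^*+1)}-\mu_{(\nu)}=\Delta_{(\nu)}$ for all $\nu\in\{1,\dots,\nu^*\}$ and $$\liminf_{T\to\infty}\frac{\mathbb E[R_A(T)]}{\log T}\ \ge\ \sum_{\nu=1}^{\nu^*}\frac{c\,\sigma^2}{\Delta_{(\nu)}}.$$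 -/

import Mathlib

open MeasureTheory ProbabilityTheory Filter
open scoped NNReal unitInterval

namespace AsyncBandit

/-- Valid assignments of `M` players to `K` arms: `m k` is the number of players on arm `k`;
all players are assigned and no arm receives more than `-1 / log (1 - p)` of them. -/
abbrev Assignment (M K : ℕ) (p : I) : Type :=
  {m : Fin K → ℕ // ∑ k, m k = M ∧ ∀ k, (m k : ℝ) ≤ -1 / Real.log (1 - (p : ℝ))}

/-- What the central entity observes in one round: for every arm `k` the indicator `η_k` that
exactly one player was active on arm `k`, and the earned reward `η_k X_k`. -/
abbrev Feedback (K : ℕ) : Type := Fin K → Bool × ℝ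

/-- The record of one round: the assignment that was chosen and the feedback received. -/
abbrev Round (M K : ℕ) (p : I) : Type := Assignment M K p × Feedback K

/-- Law of `(η_k, η_k X_k)` when `m` players are assigned to an arm with reward law `N(x, v)`:
each of the `m` players is active independently with probability `p`, the reward `X_k` is
independent of the activations, and `η_k` says that exactly one player is active. -/
noncomputable def armFeedback (v : ℝ≥0) (p : I) (x : ℝ) (m : ℕ) : Measure (Bool × ℝ) :=
  ((binomial m p).prod (gaussianReal x v)).map
    (fun a : ℕ × ℝ => if a.1 = 1 then (true, a.2) else (false, 0))

instance (v : ℝ≥0) (p : I) (x : ℝ) (m : ℕ) : IsProbabilityMeasure (armFeedback v p x m) := by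
  unfold armFeedback
  refine Measure.isProbabilityMeasure_map (Measurable.aemeasurable ?_)
  refine Measurable.ite ?_ (by fun_prop) (by fun_prop)
  exact measurable_fst (measurableSet_singleton 1)

/-- Law of the feedback of one round, given the assignment: the arms are independent. -/
noncomputable def feedback (v : ℝ≥0) {M K : ℕ} {p : I} (μ : Fin K → ℝ) :
    Kernel (Assignment M K p) (Feedback K) :=
  Kernel.ofFunOfCountable fun m => Measure.pi fun k => armFeedback v p (μ k) (m.1 k)

instance (v : ℝ≥0) {M K : ℕ} {p : I} (μ : Fin K → ℝ) :
    IsMarkovKernel (feedback v μ : Kernel (Assignment M K p) (Feedback K)) :=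
  ⟨fun m => by
    change IsProbabilityMeasure (Measure.pi fun k => armFeedback v p (μ k) (m.1 k))
    infer_instance⟩

/-- A (randomised) algorithm. For the horizon `T`, `act T t` is the conditional law of the
assignment chosen after `t` completed rounds, given their record. The algorithm may know the
horizon; an anytime algorithm is one for which `act T t` does not depend on `T`. -/
structure Algorithm (M K : ℕ) (p : I) where
  act : (T t : ℕ) → Kernel (Fin t → Round M K p) (Assignment M K p)
  markov : ∀ T t, IsMarkovKernel (act T t)

/-- Law of the record of the first `t` rounds when the horizon is `T`, the mean rewards are `μ`
and all reward laws are Gaussian with variance `v`. -/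
noncomputable def historyLaw (v : ℝ≥0) {M K : ℕ} {p : I} (A : Algorithm M K p) (μ : Fin K → ℝ)
    (T : ℕ) : (t : ℕ) → Measure (Fin t → Round M K p)
  | 0 => Measure.dirac Fin.elim0
  | t + 1 =>
    (historyLaw v A μ T t ⊗ₘ (A.act T t ⊗ₖ (feedback v μ).prodMkLeft (Fin t → Round M K p))).map
      (fun hr => Fin.snoc (α := fun _ => Round M K p) hr.1 hr.2)

theorem measurable_snoc {α : Type*} [MeasurableSpace α] (t : ℕ) :
    Measurable (fun hr : (Fin t → α) × α => (Fin.snoc (α := fun _ => α) hr.1 hr.2 :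
      Fin (t + 1) → α)) := by
  refine measurable_pi_lambda _ fun i => ?_
  refine Fin.lastCases ?_ (fun j => ?_) i
  · simpa using measurable_snd
  · simpa [Function.comp_def] using (measurable_pi_apply (X := fun _ : Fin t => α) j).comp measurable_fst

instance (v : ℝ≥0) {M K : ℕ} {p : I} (A : Algorithm M K p) (μ : Fin K → ℝ) (T t : ℕ) :
    IsProbabilityMeasure (historyLaw v A μ T t) := by
  induction t with
  | zero => unfold historyLaw; infer_instance
  | succ t ih =>
    have := A.markov T t
    unfold historyLaw
    exact Measure.isProbabilityMeasure_map (measurable_snoc t).aemeasurable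

/-- Total reward `∑ k, η_k X_k` of a round. -/
def totalReward {K : ℕ} (o : Feedback K) : ℝ := ∑ k, (o k).2

/-- Expected total reward of one round in which the assignment `m` is played. -/
noncomputable def meanReward (v : ℝ≥0) {M K : ℕ} {p : I} (μ : Fin K → ℝ)
    (m : Assignment M K p) : ℝ :=
  ∫ o, totalReward o ∂(feedback v μ m)

/-- `m` is the unique optimal assignment, `m = argmax` of the expected reward of a round. -/
def IsUniqueOptimal (v : ℝ≥0) {M K : ℕ} {p : I} (μ : Fin K → ℝ) (m : Assignment M K p) : Prop :=
  ∀ m' : Assignment M K p, m' ≠ m → meanReward v μ m' < meanReward v μ m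

/-- The number of arms without players. -/
def numEmpty {M K : ℕ} {p : I} (m : Assignment M K p) : ℕ :=
  (Finset.univ.filter fun k => m.1 k = 0).card

/-- The arm of rank `i` when arms are sorted by increasing mean: `i = 0` is the worst arm. -/
noncomputable def armOfRank {K : ℕ} (μ : Fin K → ℝ) (i : Fin K) : Fin K := Tuple.sort μ i

/-- Number of rounds of the record `h` with at least one player on arm `k`. -/
def pulls {M K T : ℕ} {p : I} (h : Fin T → Round M K p) (k : Fin K) : ℕ :=
  (Finset.univ.filter fun t => 1 ≤ (h t).1.1 k).card

/-- Expected regret over `T` rounds against the assignment `mStar`. -/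
noncomputable def regret (v : ℝ≥0) {M K : ℕ} {p : I} (A : Algorithm M K p) (μ : Fin K → ℝ)
    (mStar : Assignment M K p) (T : ℕ) : ℝ :=
  ∑ t : Fin T, (meanReward v μ mStar - ∫ h, totalReward (h t).2 ∂(historyLaw v A μ T T))

/-- Consistency: for all mean vectors in `[0, 1]^K` whose optimal assignment `mStar` is well
defined, with `νStar = numEmpty mStar`, and all `a > 0`, the expected number of rounds with at
least one player on the `i`-th worst arm is `O(T^a)` for the `νStar` worst arms, and is
`T - O(T^a)` for all other arms. -/
def Consistent (v : ℝ≥0) {M K : ℕ} {p : I} (A : Algorithm M K p) : Prop :=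
  ∀ μ : Fin K → ℝ, (∀ k, μ k ∈ Set.Icc (0 : ℝ) 1) →
    ∀ mStar : Assignment M K p, IsUniqueOptimal v μ mStar →
      ∀ a : ℝ, 0 < a → ∀ i : Fin K,
        (numEmpty mStar ≤ (i : ℕ) →
          (fun T : ℕ => ∫ h, ((T : ℝ) - pulls h (armOfRank μ i)) ∂(historyLaw v A μ T T))
            =O[atTop] fun T : ℕ => (T : ℝ) ^ a) ∧
        ((i : ℕ) < numEmpty mStar →
          (fun T : ℕ => ∫ h, (pulls h (armOfRank μ i) : ℝ) ∂(historyLaw v A μ T T))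
            =O[atTop] fun T : ℕ => (T : ℝ) ^ a)

end AsyncBandit

/-!
Since `p ≤ 1 / (M + 1)`, the probability `aloneProb p m` that exactly one of `m` players is active
is concave in `m ≤ M`, and the cap on the number of players per arm is not binding. The best mean
is taken to be `1` and the second best mean `b` such that the marginal value `b * p` of a first
player on the second arm lies strictly between the marginal values of the `(M - 1)`-th and of an
`M`-th player on the best arm. At the price `b * p` per player, Lagrangian duality
(`add_sum_le_meanReward_sub`) shows that the unique optimum puts one player on the second arm and
the others on the best one, and that an assignment `m` loses at least `∑ k, (b - μ k) * aloneProb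
p (m k)` over the arms `k` other than the best one. The arm of mean `b - Δ j` thus costs `Δ j` per
expected observation of its reward (`sum_gap_mul_expectedObs_le_regret`).

The interval of admissible `b` is longer than `p / 4` (`div_four_lt_sub`), and `b` is its
midpoint, so raising one mean from `b - Δ j` to `b + Δ j` yields an instance whose unique optimum
has its single player on that arm. A consistent algorithm rarely plays the arm in the first
instance and almost always in the second. The two laws of the record have an explicit likelihood
ratio (`lintegral_historyLaw_update`), whose mean logarithm is `2 * Δ j ^ 2 / v` times the
expected number of observations of the arm (`integral_recordLogRatio`). By the Bretagnolle–Huber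
inequality (`exp_neg_integral_le_two_mul`) and Markov's inequality this relative entropy is at
least `log T / 2 - C` (`exists_log_sub_le_expectedObs`). Multiplying the number of observations by
their cost and summing over `j` gives the bound with `c = 1 / 4`.
-/

namespace AsyncBandit

/-! ### The probability that exactly one player is active -/

/-- The probability that exactly one of `m` players is active. -/
noncomputable def aloneProb (p : I) (m : ℕ) : ℝ := m * p * (1 - p) ^ (m - 1)

theorem binomial_singleton_one (p : I) (m : ℕ) :
    binomial m p {1} = ENNReal.ofReal (aloneProb p m) := by
  rw [binomial_singleton]
  simp [aloneProb]

theorem aloneProb_nonneg (p : I) (m : ℕ) : 0 ≤ aloneProb p m :=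
  mul_nonneg (mul_nonneg m.cast_nonneg p.2.1) (pow_nonneg (sub_nonneg.2 p.2.2) _)

theorem aloneProb_le_one (p : I) (m : ℕ) : aloneProb p m ≤ 1 := by
  have h : binomial m p {1} ≤ 1 := prob_le_one
  rwa [binomial_singleton_one, ENNReal.ofReal_le_one] at h

theorem aloneProb_zero (p : I) : aloneProb p 0 = 0 := by simp [aloneProb]

theorem aloneProb_one (p : I) : aloneProb p 1 = p := by simp [aloneProb]

theorem aloneProb_le_mul (p : I) (m : ℕ) : aloneProb p m ≤ p * m := by
  unfold aloneProb
  have h : (1 - (p : ℝ)) ^ (m - 1) ≤ 1 :=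
    pow_le_one₀ (sub_nonneg.2 p.2.2) (by linarith [p.2.1])
  have h' : 0 ≤ (m : ℝ) * p := mul_nonneg m.cast_nonneg p.2.1
  nlinarith

theorem aloneProb_pos {p : I} (hp0 : 0 < (p : ℝ)) (hp1 : (p : ℝ) < 1) {m : ℕ} (hm : m ≠ 0) :
    0 < aloneProb p m := by
  unfold aloneProb
  have : 0 < (m : ℝ) := by positivity
  have : 0 < 1 - (p : ℝ) := by linarith
  positivity

/-! ### The feedback of a single arm -/

theorem measurable_ite_feedback :
    Measurable (fun a : ℕ × ℝ => if a.1 = 1 then (true, a.2) else (false, (0 : ℝ))) :=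
  Measurable.ite (measurable_fst (measurableSet_singleton 1)) (by fun_prop) (by fun_prop)

/-- The feedback of an arm is a mixture: a Gaussian reward is observed with probability
`aloneProb p m`, and nothing otherwise. -/
theorem armFeedback_eq_add (v : ℝ≥0) (p : I) (x : ℝ) (m : ℕ) :
    armFeedback v p x m =
      ENNReal.ofReal (aloneProb p m) • (gaussianReal x v).map (Prod.mk true) +
        ENNReal.ofReal (1 - aloneProb p m) • Measure.dirac (false, 0) := by
  refine Measure.ext_of_lintegral _ fun f hf => ?_
  have hft : Measurable fun y : ℝ => f (true, y) := by fun_prop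
  have hc : binomial m p {1}ᶜ = ENNReal.ofReal (1 - aloneProb p m) := by
    rw [prob_compl_eq_one_sub (measurableSet_singleton 1), binomial_singleton_one,
      ENNReal.ofReal_sub _ (aloneProb_nonneg p m), ENNReal.ofReal_one]
  have hinner : ∀ n : ℕ,
      (∫⁻ y, f (if n = 1 then (true, y) else (false, 0)) ∂(gaussianReal x v)) =
        ({1} : Set ℕ).indicator (fun _ => ∫⁻ y, f (true, y) ∂(gaussianReal x v)) n +
          ({1}ᶜ : Set ℕ).indicator (fun _ => f (false, 0)) n := by
    intro n
    by_cases hn : n = 1 <;> simp [hn]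
  unfold armFeedback
  rw [lintegral_map hf measurable_ite_feedback]
  refine (lintegral_prod _ (hf.comp measurable_ite_feedback).aemeasurable).trans ?_
  simp only [Function.comp_apply, hinner]
  rw [lintegral_add_left (by fun_prop), lintegral_indicator_const (measurableSet_singleton 1),
    lintegral_indicator_const (measurableSet_singleton 1).compl, hc, binomial_singleton_one,
    lintegral_add_measure, lintegral_smul_measure, lintegral_smul_measure,
    lintegral_dirac' _ hf, lintegral_map hf (by fun_prop)]
  simp [mul_comm]

theorem integrable_armFeedback {v : ℝ≥0} {p : I} {x : ℝ} {m : ℕ} {f : Bool × ℝ → ℝ}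
    (hf : Measurable f) (h : Integrable (fun y => f (true, y)) (gaussianReal x v)) :
    Integrable f (armFeedback v p x m) := by
  rw [armFeedback_eq_add]
  refine Integrable.add_measure ?_ ?_
  · refine Integrable.smul_measure ?_ ENNReal.ofReal_ne_top
    exact (integrable_map_measure hf.aestronglyMeasurable (by fun_prop)).2 h
  · refine Integrable.smul_measure ?_ ENNReal.ofReal_ne_top
    exact integrable_dirac (by simp)

theorem integral_armFeedback {v : ℝ≥0} {p : I} {x : ℝ} {m : ℕ} {f : Bool × ℝ → ℝ}
    (hf : Measurable f) (h : Integrable (fun y => f (true, y)) (gaussianReal x v)) :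
    ∫ o, f o ∂(armFeedback v p x m) =
      aloneProb p m * ∫ y, f (true, y) ∂(gaussianReal x v) +
        (1 - aloneProb p m) * f (false, 0) := by
  have h1 : Integrable f ((gaussianReal x v).map (Prod.mk true)) :=
    (integrable_map_measure hf.aestronglyMeasurable (by fun_prop)).2 h
  have h2 : Integrable f (Measure.dirac (false, (0 : ℝ))) := integrable_dirac (by simp)
  rw [armFeedback_eq_add, integral_add_measure (h1.smul_measure ENNReal.ofReal_ne_top)
    (h2.smul_measure ENNReal.ofReal_ne_top), integral_smul_measure, integral_smul_measure,
    integral_map (by fun_prop) hf.aestronglyMeasurable, integral_dirac,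
    ENNReal.toReal_ofReal (aloneProb_nonneg p m),
    ENNReal.toReal_ofReal (sub_nonneg.2 (aloneProb_le_one p m)), smul_eq_mul, smul_eq_mul]

theorem integrable_id_gaussianReal (x : ℝ) (v : ℝ≥0) :
    Integrable (fun y : ℝ => y) (gaussianReal x v) :=
  (memLp_id_gaussianReal 1).integrable le_rfl

theorem integrable_snd_armFeedback (v : ℝ≥0) (p : I) (x : ℝ) (m : ℕ) :
    Integrable (fun o : Bool × ℝ => o.2) (armFeedback v p x m) :=
  integrable_armFeedback measurable_snd (integrable_id_gaussianReal x v)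

theorem integral_snd_armFeedback (v : ℝ≥0) (p : I) (x : ℝ) (m : ℕ) :
    ∫ o, o.2 ∂(armFeedback v p x m) = x * aloneProb p m := by
  rw [integral_armFeedback measurable_snd (integrable_id_gaussianReal x v),
    integral_id_gaussianReal]
  ring

/-- The log-likelihood ratio of the feedback of an arm with mean `x` against mean `y`. -/
noncomputable def logRatio (v : ℝ≥0) (x y : ℝ) (o : Bool × ℝ) : ℝ :=
  if o.1 = true then (x - y) * (2 * o.2 - (x + y)) / (2 * v) else 0

theorem measurable_logRatio (v : ℝ≥0) (x y : ℝ) : Measurable (logRatio v x y) :=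
  Measurable.ite (measurable_fst (measurableSet_singleton true)) (by fun_prop) (by fun_prop)

theorem integrable_logRatio_true (v : ℝ≥0) (x y : ℝ) :
    Integrable (fun z => logRatio v x y (true, z)) (gaussianReal x v) := by
  simp only [logRatio, if_true]
  exact ((((integrable_id_gaussianReal x v).const_mul 2).sub
    (integrable_const (x + y))).const_mul (x - y)).div_const _

theorem integrable_logRatio (v : ℝ≥0) (p : I) (x y : ℝ) (m : ℕ) :
    Integrable (logRatio v x y) (armFeedback v p x m) :=
  integrable_armFeedback (measurable_logRatio v x y) (integrable_logRatio_true v x y)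

/-- The relative entropy of the feedback of an arm is that of the two Gaussian laws, weighted by
the probability that the reward is observed. -/
theorem integral_logRatio (v : ℝ≥0) (p : I) (x y : ℝ) (m : ℕ) :
    ∫ o, logRatio v x y o ∂(armFeedback v p x m) = (x - y) ^ 2 / (2 * v) * aloneProb p m := by
  rw [integral_armFeedback (measurable_logRatio v x y) (integrable_logRatio_true v x y)]
  simp only [logRatio, if_true]
  rw [integral_div, integral_const_mul, integral_sub
    ((integrable_id_gaussianReal x v).const_mul 2) (integrable_const _), integral_const_mul,
    integral_id_gaussianReal]
  simp
  ring

theorem lintegral_gaussianReal_change {v : ℝ≥0} (hv : v ≠ 0) (x y : ℝ) {f : ℝ → ENNReal}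
    (hf : Measurable f) :
    ∫⁻ z, f z ∂(gaussianReal y v) =
      ∫⁻ z, f z * ENNReal.ofReal (Real.exp (-((x - y) * (2 * z - (x + y)) / (2 * v))))
        ∂(gaussianReal x v) := by
  rw [gaussianReal_of_var_ne_zero _ hv, gaussianReal_of_var_ne_zero _ hv,
    lintegral_withDensity_eq_lintegral_mul _ (measurable_gaussianPDF y v) hf,
    lintegral_withDensity_eq_lintegral_mul _ (measurable_gaussianPDF x v) (by fun_prop)]
  refine lintegral_congr fun z => ?_
  have hv' : (v : ℝ) ≠ 0 := by exact_mod_cast hv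
  have h : gaussianPDF y v z = gaussianPDF x v z *
      ENNReal.ofReal (Real.exp (-((x - y) * (2 * z - (x + y)) / (2 * v)))) := by
    simp only [gaussianPDF]
    rw [← ENNReal.ofReal_mul (gaussianPDFReal_nonneg x v z), gaussianPDFReal, gaussianPDFReal,
      mul_assoc _ (Real.exp _), ← Real.exp_add]
    congr 3
    field_simp
    ring
  simp only [Pi.mul_apply]
  rw [h]
  ring

theorem lintegral_armFeedback (v : ℝ≥0) (p : I) (x : ℝ) (m : ℕ) {f : Bool × ℝ → ENNReal}
    (hf : Measurable f) :
    ∫⁻ o, f o ∂(armFeedback v p x m) =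
      ENNReal.ofReal (aloneProb p m) * ∫⁻ z, f (true, z) ∂(gaussianReal x v) +
        ENNReal.ofReal (1 - aloneProb p m) * f (false, 0) := by
  rw [armFeedback_eq_add, lintegral_add_measure, lintegral_smul_measure, lintegral_smul_measure,
    lintegral_dirac' _ hf, lintegral_map hf (by fun_prop), smul_eq_mul, smul_eq_mul]

/-- `exp (-logRatio v x y)` is the density of the feedback with mean `y` with respect to that with
mean `x`. -/
theorem lintegral_armFeedback_change {v : ℝ≥0} (hv : v ≠ 0) (p : I) (x y : ℝ) (m : ℕ)
    {f : Bool × ℝ → ENNReal} (hf : Measurable f) :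
    ∫⁻ o, f o ∂(armFeedback v p y m) =
      ∫⁻ o, f o * ENNReal.ofReal (Real.exp (-logRatio v x y o)) ∂(armFeedback v p x m) := by
  have hl := measurable_logRatio v x y
  rw [lintegral_armFeedback _ _ _ _ hf, lintegral_armFeedback _ _ _ _ (by fun_prop),
    lintegral_gaussianReal_change hv x y (by fun_prop)]
  simp [logRatio]

/-! ### The feedback of a round -/

theorem feedback_apply (v : ℝ≥0) {M K : ℕ} {p : I} (μ : Fin K → ℝ) (m : Assignment M K p) :
    feedback v μ m = Measure.pi fun k => armFeedback v p (μ k) (m.1 k) := rfl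

theorem map_eval_feedback (v : ℝ≥0) {M K : ℕ} {p : I} (μ : Fin K → ℝ) (m : Assignment M K p)
    (k : Fin K) : (feedback v μ m).map (fun o => o k) = armFeedback v p (μ k) (m.1 k) :=
  (measurePreserving_eval (fun k => armFeedback v p (μ k) (m.1 k)) k).map_eq

theorem integrable_eval_feedback {v : ℝ≥0} {M K : ℕ} {p : I} {μ : Fin K → ℝ}
    {m : Assignment M K p} {k : Fin K} {f : Bool × ℝ → ℝ}
    (hf : Integrable f (armFeedback v p (μ k) (m.1 k))) :
    Integrable (fun o => f (o k)) (feedback v μ m) := by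
  rw [← map_eval_feedback v μ m k] at hf
  exact hf.comp_measurable (measurable_pi_apply k)

theorem integral_eval_feedback {v : ℝ≥0} {M K : ℕ} {p : I} {μ : Fin K → ℝ}
    {m : Assignment M K p} {k : Fin K} {f : Bool × ℝ → ℝ} (hf : Measurable f) :
    ∫ o, f (o k) ∂(feedback v μ m) = ∫ o, f o ∂(armFeedback v p (μ k) (m.1 k)) := by
  rw [← map_eval_feedback v μ m k,
    integral_map (measurable_pi_apply k).aemeasurable hf.aestronglyMeasurable]

theorem integrable_totalReward (v : ℝ≥0) {M K : ℕ} {p : I} (μ : Fin K → ℝ)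
    (m : Assignment M K p) : Integrable totalReward (feedback v μ m) :=
  integrable_finsetSum _ fun k _ =>
    integrable_eval_feedback (integrable_snd_armFeedback v p (μ k) (m.1 k))

theorem meanReward_eq_sum (v : ℝ≥0) {M K : ℕ} {p : I} (μ : Fin K → ℝ) (m : Assignment M K p) :
    meanReward v μ m = ∑ k, μ k * aloneProb p (m.1 k) := by
  unfold meanReward totalReward
  rw [integral_finsetSum _ fun k _ =>
    integrable_eval_feedback (integrable_snd_armFeedback v p (μ k) (m.1 k))]
  refine Finset.sum_congr rfl fun k _ => ?_
  rw [integral_eval_feedback (f := Prod.snd) measurable_snd, integral_snd_armFeedback]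

/-- Changing the mean of the single arm `k` changes the law of the feedback by the likelihood
ratio of that arm. -/
theorem lintegral_feedback_update {v : ℝ≥0} (hv : v ≠ 0) {M K : ℕ} {p : I} (μ : Fin K → ℝ)
    (k : Fin K) (y : ℝ) (m : Assignment M K p) {f : Feedback K → ENNReal} (hf : Measurable f) :
    ∫⁻ o, f o ∂(feedback v (Function.update μ k y) m) =
      ∫⁻ o, f o * ENNReal.ofReal (Real.exp (-logRatio v (μ k) y (o k))) ∂(feedback v μ m) := by
  obtain _ | n := K
  · exact k.elim0
  have hl := measurable_logRatio v (μ k) y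
  have key : ∀ (μ' : Fin (n + 1) → ℝ) {g : Feedback (n + 1) → ENNReal}, Measurable g →
      ∫⁻ o, g o ∂(feedback v μ' m) =
        ∫⁻ r, ∫⁻ a, g (k.insertNth a r) ∂(armFeedback v p (μ' k) (m.1 k))
          ∂(Measure.pi fun i => armFeedback v p (μ' (k.succAbove i)) (m.1 (k.succAbove i))) := by
    intro μ' g hg
    have h := (measurePreserving_piFinSuccAbove
      (fun i => armFeedback v p (μ' i) (m.1 i)) k).symm
    rw [feedback_apply, ← h.map_eq, lintegral_map hg h.measurable]
    exact lintegral_prod_symm _ (hg.comp h.measurable).aemeasurable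
  rw [key _ hf, key _ (by fun_prop)]
  simp only [Function.update_self, ne_eq, Fin.succAbove_ne, not_false_eq_true,
    Function.update_of_ne, Fin.insertNth_apply_same]
  refine lintegral_congr fun r => ?_
  refine lintegral_armFeedback_change hv p (μ k) y (m.1 k) (hf.comp ?_)
  have h := (MeasurableEquiv.piFinSuccAbove (fun _ => Bool × ℝ) k).symm.measurable
  exact h.comp (measurable_id.prodMk measurable_const)

/-! ### The law of the record -/

instance {M K : ℕ} {p : I} (A : Algorithm M K p) (T t : ℕ) : IsMarkovKernel (A.act T t) :=
  A.markov T t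

instance {M K : ℕ} {p : I} : Finite (Assignment M K p) := by
  have h : (Set.univ.pi fun _ : Fin K => Set.Iic M).Finite :=
    Set.Finite.pi fun _ => Set.finite_Iic M
  refine (h.subset fun m hm => ?_ : Set.Finite
    {m : Fin K → ℕ | ∑ k, m k = M ∧ ∀ k, (m k : ℝ) ≤ -1 / Real.log (1 - (p : ℝ))}).to_subtype
  intro k _
  exact hm.1 ▸ Finset.single_le_sum (f := m) (fun _ _ => Nat.zero_le _) (Finset.mem_univ k)

/-- Law of the next round, given the record of the rounds so far. -/
noncomputable def roundKernel (v : ℝ≥0) {M K : ℕ} {p : I} (A : Algorithm M K p) (μ : Fin K → ℝ)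
    (T t : ℕ) : Kernel (Fin t → Round M K p) (Round M K p) :=
  A.act T t ⊗ₖ (feedback v μ).prodMkLeft (Fin t → Round M K p)

instance (v : ℝ≥0) {M K : ℕ} {p : I} (A : Algorithm M K p) (μ : Fin K → ℝ) (T t : ℕ) :
    IsMarkovKernel (roundKernel v A μ T t) := by
  unfold roundKernel; infer_instance

theorem lintegral_roundKernel (v : ℝ≥0) {M K : ℕ} {p : I} (A : Algorithm M K p) (μ : Fin K → ℝ)
    (T t : ℕ) (h : Fin t → Round M K p) {f : Round M K p → ENNReal} (hf : Measurable f) :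
    ∫⁻ r, f r ∂(roundKernel v A μ T t h) =
      ∫⁻ m, ∫⁻ o, f (m, o) ∂(feedback v μ m) ∂(A.act T t h) := by
  unfold roundKernel
  rw [Kernel.lintegral_compProd _ _ _ hf]
  simp only [Kernel.prodMkLeft_apply]

theorem lintegral_historyLaw_succ (v : ℝ≥0) {M K : ℕ} {p : I} (A : Algorithm M K p)
    (μ : Fin K → ℝ) (T t : ℕ) {f : (Fin (t + 1) → Round M K p) → ENNReal} (hf : Measurable f) :
    ∫⁻ h, f h ∂(historyLaw v A μ T (t + 1)) =
      ∫⁻ h, ∫⁻ r, f (Fin.snoc (α := fun _ => Round M K p) h r) ∂(roundKernel v A μ T t h)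
        ∂(historyLaw v A μ T t) := by
  rw [historyLaw, lintegral_map hf (measurable_snoc t)]
  exact Measure.lintegral_compProd (hf.comp (measurable_snoc t))

/-- In every round, the feedback is drawn from `feedback v μ` given the assignment. -/
theorem lintegral_historyLaw_apply (v : ℝ≥0) {M K : ℕ} {p : I} (A : Algorithm M K p)
    (μ : Fin K → ℝ) (T : ℕ) {f : Round M K p → ENNReal} (hf : Measurable f) (t : ℕ)
    (s : Fin t) :
    ∫⁻ h, f (h s) ∂(historyLaw v A μ T t) =
      ∫⁻ h, ∫⁻ o, f ((h s).1, o) ∂(feedback v μ (h s).1) ∂(historyLaw v A μ T t) := by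
  have hg : Measurable fun m : Assignment M K p => ∫⁻ o, f (m, o) ∂(feedback v μ m) :=
    measurable_of_countable _
  induction t with
  | zero => exact s.elim0
  | succ t ih =>
    have hfs : Measurable fun h : Fin (t + 1) → Round M K p => f (h s) :=
      hf.comp (measurable_pi_apply s)
    have hgs : Measurable fun h : Fin (t + 1) → Round M K p =>
        ∫⁻ o, f ((h s).1, o) ∂(feedback v μ (h s).1) :=
      hg.comp (measurable_fst.comp (measurable_pi_apply s))
    rw [lintegral_historyLaw_succ v A μ T t hfs, lintegral_historyLaw_succ v A μ T t hgs]
    induction s using Fin.lastCases with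
    | last =>
      simp only [Fin.snoc_last]
      refine lintegral_congr fun h => ?_
      have hg1 : Measurable fun r : Round M K p => ∫⁻ o, f (r.1, o) ∂(feedback v μ r.1) :=
        hg.comp measurable_fst
      rw [lintegral_roundKernel v A μ T t h hf, lintegral_roundKernel v A μ T t h hg1]
      simp
    | cast s =>
      simpa using ih s

theorem map_apply_historyLaw (v : ℝ≥0) {M K : ℕ} {p : I} (A : Algorithm M K p)
    (μ : Fin K → ℝ) (T t : ℕ) (s : Fin t) :
    (historyLaw v A μ T t).map (fun h => h s) =
      (historyLaw v A μ T t).map (fun h => (h s).1) ⊗ₘ feedback v μ := by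
  have hs : Measurable fun h : Fin t → Round M K p => (h s).1 :=
    measurable_fst.comp (measurable_pi_apply s)
  have : IsProbabilityMeasure ((historyLaw v A μ T t).map fun h => (h s).1) :=
    Measure.isProbabilityMeasure_map hs.aemeasurable
  refine Measure.ext_of_lintegral _ fun f hf => ?_
  rw [lintegral_map hf (measurable_pi_apply (X := fun _ : Fin t => Round M K p) s), Measure.lintegral_compProd hf,
    lintegral_map (measurable_of_countable _) hs]
  exact lintegral_historyLaw_apply v A μ T hf t s

theorem integrable_historyLaw_apply {v : ℝ≥0} {M K : ℕ} {p : I} {A : Algorithm M K p}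
    {μ : Fin K → ℝ} {T t : ℕ} {f : Feedback K → ℝ} (hf : Measurable f)
    (hi : ∀ m, Integrable f (feedback v μ (m : Assignment M K p))) (s : Fin t) :
    Integrable (fun h => f (h s).2) (historyLaw v A μ T t) := by
  have hs : Measurable fun h : Fin t → Round M K p => (h s).1 :=
    measurable_fst.comp (measurable_pi_apply s)
  have : IsProbabilityMeasure ((historyLaw v A μ T t).map fun h => (h s).1) :=
    Measure.isProbabilityMeasure_map hs.aemeasurable
  have hf' : Measurable fun r : Round M K p => f r.2 := hf.comp measurable_snd
  have key : Integrable (fun r : Round M K p => f r.2)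
      ((historyLaw v A μ T t).map (fun h => h s)) := by
    rw [map_apply_historyLaw, Measure.integrable_compProd_iff hf'.aestronglyMeasurable]
    exact ⟨Eventually.of_forall hi, Integrable.of_finite⟩
  exact key.comp_measurable (measurable_pi_apply s)

theorem integral_historyLaw_apply {v : ℝ≥0} {M K : ℕ} {p : I} {A : Algorithm M K p}
    {μ : Fin K → ℝ} {T t : ℕ} {f : Feedback K → ℝ} (hf : Measurable f)
    (hi : ∀ m, Integrable f (feedback v μ (m : Assignment M K p))) (s : Fin t) :
    ∫ h, f (h s).2 ∂(historyLaw v A μ T t) =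
      ∫ h, ∫ o, f o ∂(feedback v μ (h s).1) ∂(historyLaw v A μ T t) := by
  have hs : Measurable fun h : Fin t → Round M K p => (h s).1 :=
    measurable_fst.comp (measurable_pi_apply s)
  have : IsProbabilityMeasure ((historyLaw v A μ T t).map fun h => (h s).1) :=
    Measure.isProbabilityMeasure_map hs.aemeasurable
  have hf' : Measurable fun r : Round M K p => f r.2 := hf.comp measurable_snd
  have hi' : Integrable (fun r : Round M K p => f r.2)
      ((historyLaw v A μ T t).map (fun h => (h s).1) ⊗ₘ feedback v μ) := by
    rw [Measure.integrable_compProd_iff hf'.aestronglyMeasurable]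
    exact ⟨Eventually.of_forall hi, Integrable.of_finite⟩
  rw [← integral_map (φ := fun h : Fin t → Round M K p => h s) (f := fun r => f r.2)
      (measurable_pi_apply s).aemeasurable hf'.aestronglyMeasurable,
    map_apply_historyLaw, Measure.integral_compProd hi',
    integral_map hs.aemeasurable
      (StronglyMeasurable.aestronglyMeasurable (measurable_of_countable _).stronglyMeasurable)]

theorem integrable_comp_assignment (v : ℝ≥0) {M K : ℕ} {p : I} (A : Algorithm M K p)
    (μ : Fin K → ℝ) (T t : ℕ) (s : Fin t) (g : Assignment M K p → ℝ) :
    Integrable (fun h => g (h s).1) (historyLaw v A μ T t) := by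
  have hs : Measurable fun h : Fin t → Round M K p => (h s).1 :=
    measurable_fst.comp (measurable_pi_apply s)
  have : IsProbabilityMeasure ((historyLaw v A μ T t).map fun h => (h s).1) :=
    Measure.isProbabilityMeasure_map hs.aemeasurable
  exact (Integrable.of_finite (f := g)
    (μ := (historyLaw v A μ T t).map fun h => (h s).1)).comp_measurable hs

/-- The expected number of rounds in which the reward of arm `k` is observed. -/
noncomputable def expectedObs (v : ℝ≥0) {M K : ℕ} {p : I} (A : Algorithm M K p)
    (μ : Fin K → ℝ) (k : Fin K) (T : ℕ) : ℝ :=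
  ∑ s : Fin T, ∫ h, aloneProb p ((h s).1.1 k) ∂(historyLaw v A μ T T)

/-! ### Changing the mean of one arm -/

/-- The log-likelihood ratio of a record when the mean of arm `k` is `x` against `y`. -/
noncomputable def recordLogRatio (v : ℝ≥0) {M K t : ℕ} {p : I} (k : Fin K) (x y : ℝ)
    (h : Fin t → Round M K p) : ℝ := ∑ s, logRatio v x y ((h s).2 k)

theorem measurable_recordLogRatio (v : ℝ≥0) {M K t : ℕ} {p : I} (k : Fin K) (x y : ℝ) :
    Measurable (recordLogRatio v k x y : (Fin t → Round M K p) → ℝ) := by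
  have hl := measurable_logRatio v x y
  unfold recordLogRatio
  fun_prop

/-- Changing the mean of arm `k` changes the law of the record by the likelihood ratio of the
feedback of that arm, since the algorithm's choices have the same conditional laws. -/
theorem lintegral_historyLaw_update {v : ℝ≥0} (hv : v ≠ 0) {M K : ℕ} {p : I}
    (A : Algorithm M K p) (μ : Fin K → ℝ) (k : Fin K) (y : ℝ) (T t : ℕ)
    {f : (Fin t → Round M K p) → ENNReal} (hf : Measurable f) :
    ∫⁻ h, f h ∂(historyLaw v A (Function.update μ k y) T t) =
      ∫⁻ h, f h * ENNReal.ofReal (Real.exp (-recordLogRatio v k (μ k) y h))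
        ∂(historyLaw v A μ T t) := by
  induction t with
  | zero => simp [historyLaw, recordLogRatio]
  | succ t ih =>
    have hl := measurable_logRatio v (μ k) y
    have hL : Measurable (recordLogRatio v k (μ k) y : (Fin (t + 1) → Round M K p) → ℝ) :=
      measurable_recordLogRatio v k (μ k) y
    have hround : ∀ h : Fin t → Round M K p,
        ∫⁻ r, f (Fin.snoc (α := fun _ => Round M K p) h r)
            ∂(roundKernel v A (Function.update μ k y) T t h) =
          ∫⁻ r, f (Fin.snoc (α := fun _ => Round M K p) h r) *
            ENNReal.ofReal (Real.exp (-logRatio v (μ k) y (r.2 k)))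
            ∂(roundKernel v A μ T t h) := by
      intro h
      have hfs : Measurable fun r => f (Fin.snoc (α := fun _ => Round M K p) h r) :=
        hf.comp ((measurable_snoc t).comp measurable_prodMk_left)
      rw [lintegral_roundKernel _ _ _ _ _ _ hfs,
        lintegral_roundKernel v A μ T t h (f := fun r => f (Fin.snoc h r) *
          ENNReal.ofReal (Real.exp (-logRatio v (μ k) y (r.2 k)))) (hfs.mul (by fun_prop))]
      exact lintegral_congr fun m =>
        lintegral_feedback_update hv μ k y m (hfs.comp measurable_prodMk_left)
    have hmeas : Measurable fun q : (Fin t → Round M K p) × Round M K p =>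
        f (Fin.snoc (α := fun _ => Round M K p) q.1 q.2) *
          ENNReal.ofReal (Real.exp (-logRatio v (μ k) y (q.2.2 k))) :=
      (hf.comp (measurable_snoc t)).mul (by fun_prop)
    rw [lintegral_historyLaw_succ _ _ _ _ _ hf,
      lintegral_historyLaw_succ v A μ T t (f := fun h => f h *
        ENNReal.ofReal (Real.exp (-recordLogRatio v k (μ k) y h))) (hf.mul (by fun_prop))]
    simp only [hround]
    rw [ih hmeas.lintegral_kernel_prod_right]
    refine lintegral_congr fun h => ?_
    refine (lintegral_mul_const _ (hmeas.comp measurable_prodMk_left)).symm.trans ?_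
    refine lintegral_congr fun r => ?_
    have hsum : recordLogRatio v k (μ k) y (Fin.snoc (α := fun _ => Round M K p) h r) =
        recordLogRatio v k (μ k) y h + logRatio v (μ k) y (r.2 k) := by
      simp [recordLogRatio, Fin.sum_univ_castSucc]
    simp only [Function.comp_apply]
    rw [hsum, neg_add, Real.exp_add, ENNReal.ofReal_mul (Real.exp_nonneg _), mul_assoc,
      mul_comm (ENNReal.ofReal (Real.exp (-logRatio v (μ k) y (r.2 k))))]

theorem integrable_recordLogRatio (v : ℝ≥0) {M K : ℕ} {p : I}
    (A : Algorithm M K p) (μ : Fin K → ℝ) (k : Fin K) (y : ℝ) (T : ℕ) :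
    Integrable (recordLogRatio v k (μ k) y) (historyLaw v A μ T T) :=
  integrable_finsetSum _ fun s _ => integrable_historyLaw_apply
    (f := fun o => logRatio v (μ k) y (o k))
    ((measurable_logRatio v (μ k) y).comp (measurable_pi_apply k))
    (fun m => integrable_eval_feedback (integrable_logRatio v p (μ k) y (m.1 k))) s

/-- The relative entropy of the two laws of the record: only observed rewards of arm `k`
contribute. -/
theorem integral_recordLogRatio (v : ℝ≥0) {M K : ℕ} {p : I}
    (A : Algorithm M K p) (μ : Fin K → ℝ) (k : Fin K) (y : ℝ) (T : ℕ) :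
    ∫ h, recordLogRatio v k (μ k) y h ∂(historyLaw v A μ T T) =
      (μ k - y) ^ 2 / (2 * v) * expectedObs v A μ k T := by
  have hl := measurable_logRatio v (μ k) y
  have hi : ∀ m : Assignment M K p,
      Integrable (fun o => logRatio v (μ k) y (o k)) (feedback v μ m) :=
    fun m => integrable_eval_feedback (integrable_logRatio v p (μ k) y (m.1 k))
  have hm : Measurable fun o : Feedback K => logRatio v (μ k) y (o k) :=
    hl.comp (measurable_pi_apply k)
  unfold recordLogRatio expectedObs
  rw [integral_finsetSum _ fun s _ => integrable_historyLaw_apply hm hi s, Finset.mul_sum]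
  refine Finset.sum_congr rfl fun s _ => ?_
  rw [integral_historyLaw_apply hm hi s, ← integral_const_mul]
  refine integral_congr_ae (Eventually.of_forall fun h => ?_)
  simp only
  rw [integral_eval_feedback hl, integral_logRatio]

/-- The Bretagnolle–Huber inequality: when `Q` has density `exp (-L)` with respect to `P`, no
event can be both unlikely under `P` and almost sure under `Q` unless the relative entropy
`∫ L ∂P` is large. -/
theorem exp_neg_integral_le_two_mul {Ω : Type*} [MeasurableSpace Ω] {P Q : Measure Ω}
    [IsProbabilityMeasure P] [IsProbabilityMeasure Q] {L : Ω → ℝ} (hL : Measurable L)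
    (hLi : Integrable L P)
    (hQ : Q = P.withDensity fun ω => ENNReal.ofReal (Real.exp (-L ω)))
    {B : Set Ω} (hB : MeasurableSet B) :
    Real.exp (-∫ ω, L ω ∂P) ≤ 2 * (P.real B + Q.real Bᶜ) := by
  have hone : ∫⁻ ω, ENNReal.ofReal (Real.exp (-L ω)) ∂P = 1 := by
    rw [← setLIntegral_univ, ← withDensity_apply _ MeasurableSet.univ, ← hQ, measure_univ]
  have hexp : Integrable (fun ω => Real.exp (-L ω)) P := by
    refine ⟨by fun_prop, ?_⟩
    rw [hasFiniteIntegral_iff_ofReal (Eventually.of_forall fun ω => (Real.exp_pos _).le), hone]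
    exact ENNReal.one_lt_top
  have hexp_one : ∫ ω, Real.exp (-L ω) ∂P = 1 := by
    rw [integral_eq_lintegral_of_nonneg_ae (Eventually.of_forall fun ω => (Real.exp_pos _).le)
      (by fun_prop), hone, ENNReal.toReal_one]
  have hQB : Q.real Bᶜ = ∫ ω, Bᶜ.indicator (fun ω => Real.exp (-L ω)) ω ∂P := by
    rw [integral_indicator hB.compl, integral_eq_lintegral_of_nonneg_ae
      (Eventually.of_forall fun ω => (Real.exp_pos _).le) (by fun_prop), Measure.real, hQ,
      withDensity_apply _ hB.compl]
  have hPB : P.real B = ∫ ω, B.indicator (fun _ => (1 : ℝ)) ω ∂P := by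
    rw [integral_indicator_const _ hB]; simp
  have hw1 : Integrable (B.indicator fun _ => (1 : ℝ)) P := (integrable_const 1).indicator hB
  have hw2 : Integrable (Bᶜ.indicator fun ω => Real.exp (-L ω)) P := hexp.indicator hB.compl
  set D := ∫ ω, L ω ∂P with hD
  set a := Real.exp (-D / 2) with ha
  have ha0 : 0 < a := Real.exp_pos _
  -- Weighted arithmetic–geometric means applied to the minimum and the maximum of the two
  -- densities, and the tangent of `exp` at the mean of `-L / 2` in place of Jensen's inequality.
  have hpt : ∀ ω, 2 * a * (1 - (L ω - D) / 2) - (a / 2) * (1 + Real.exp (-L ω)) ≤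
      (2 / a) * (B.indicator (fun _ => (1 : ℝ)) ω +
        Bᶜ.indicator (fun ω => Real.exp (-L ω)) ω) := by
    intro ω
    set e := Real.exp (-L ω / 2) with he
    have he0 : 0 < e := Real.exp_pos _
    have hee : Real.exp (-L ω) = e ^ 2 := by
      rw [he, ← Real.exp_nat_mul]; congr 1; push_cast; ring
    have htan : a * (1 - (L ω - D) / 2) ≤ e := by
      have h1 : e = a * Real.exp (-(L ω - D) / 2) := by
        rw [he, ha, ← Real.exp_add]; congr 1; ring
      rw [h1]
      refine mul_le_mul_of_nonneg_left ?_ ha0.le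
      linarith [Real.add_one_le_exp (-(L ω - D) / 2)]
    have hmin : 2 * e - (a / 2) * (1 + e ^ 2) ≤ (2 / a) * (B.indicator (fun _ => (1 : ℝ)) ω +
        Bᶜ.indicator (fun ω => Real.exp (-L ω)) ω) := by
      rw [div_mul_eq_mul_div 2, le_div_iff₀ ha0]
      by_cases hω : ω ∈ B
      · simp [hω]
        nlinarith [sq_nonneg (a * e - 2), sq_nonneg a]
      · simp [hω, hee]
        nlinarith [sq_nonneg (a - 2 * e), sq_nonneg (a * e)]
    rw [hee]
    linarith
  have hint := integral_mono (μ := P) ?_ ?_ hpt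
  · have h1 : ∫ ω, (2 * a * (1 - (L ω - D) / 2) - (a / 2) * (1 + Real.exp (-L ω))) ∂P = a := by
      rw [integral_sub, integral_const_mul, integral_const_mul, integral_sub, integral_div,
        integral_sub, integral_add, hexp_one, ← hD]
      · simp; ring
      all_goals fun_prop
    have h2 : ∫ ω, (2 / a) * (B.indicator (fun _ => (1 : ℝ)) ω +
        Bᶜ.indicator (fun ω => Real.exp (-L ω)) ω) ∂P = (2 / a) * (P.real B + Q.real Bᶜ) := by
      rw [integral_const_mul, integral_add hw1 hw2, ← hPB, ← hQB]
    rw [h1, h2, div_mul_eq_mul_div, le_div_iff₀ ha0] at hint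
    have haa : Real.exp (-D) = a * a := by
      rw [ha, ← Real.exp_add]; congr 1; ring
    rw [haa]
    exact hint
  · fun_prop
  · exact (hw1.add hw2).const_mul _

theorem exp_neg_expectedObs_le {v : ℝ≥0} (hv : v ≠ 0) {M K : ℕ} {p : I}
    (A : Algorithm M K p) (μ : Fin K → ℝ) (k : Fin K) (y : ℝ) (T : ℕ)
    {B : Set (Fin T → Round M K p)} (hB : MeasurableSet B) :
    Real.exp (-((μ k - y) ^ 2 / (2 * v) * expectedObs v A μ k T)) ≤
      2 * ((historyLaw v A μ T T).real B +
        (historyLaw v A (Function.update μ k y) T T).real Bᶜ) := by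
  rw [← integral_recordLogRatio]
  have hL : Measurable (recordLogRatio v k (μ k) y : (Fin T → Round M K p) → ℝ) :=
    measurable_recordLogRatio v k (μ k) y
  refine exp_neg_integral_le_two_mul hL (integrable_recordLogRatio v A μ k y T) ?_ hB
  refine Measure.ext_of_lintegral _ fun f hf => ?_
  rw [lintegral_historyLaw_update hv A μ k y T T hf,
    lintegral_withDensity_eq_lintegral_mul _ (by fun_prop) hf]
  simp only [Pi.mul_apply, mul_comm]

/-! ### The number of observations forced by consistency -/

theorem pulls_le {M K T : ℕ} {p : I} (h : Fin T → Round M K p) (k : Fin K) : pulls h k ≤ T :=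
  (Finset.card_le_univ _).trans_eq (Fintype.card_fin T)

theorem measurable_pulls {M K T : ℕ} {p : I} (k : Fin K) :
    Measurable fun h : Fin T → Round M K p => (pulls h k : ℝ) := by
  have hs : ∀ s : Fin T, Measurable fun h : Fin T → Round M K p =>
      if 1 ≤ (h s).1.1 k then (1 : ℝ) else 0 := fun s => by
    have h1 : Measurable fun m : Assignment M K p => if 1 ≤ m.1 k then (1 : ℝ) else 0 :=
      measurable_of_countable _
    exact h1.comp (measurable_fst.comp (measurable_pi_apply s))
  simp only [pulls, Finset.card_filter, Nat.cast_sum, Nat.cast_ite, Nat.cast_one, Nat.cast_zero]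
  exact Finset.measurable_sum _ fun s _ => hs s

theorem integrable_pulls (v : ℝ≥0) {M K : ℕ} {p : I} (A : Algorithm M K p) (μ : Fin K → ℝ)
    (T : ℕ) (k : Fin K) :
    Integrable (fun h => (pulls h k : ℝ)) (historyLaw v A μ T T) :=
  Integrable.of_bound (measurable_pulls k).aestronglyMeasurable T
    (Eventually.of_forall fun h => by simpa using pulls_le h k)

/-- If arm `k` is rarely played under `μ` but almost always played once its mean is changed to `y`,
then the relative entropy of the two laws of the record grows at least like `log T / 2`. -/
theorem exists_log_sub_le_expectedObs {v : ℝ≥0} (hv : v ≠ 0) {M K : ℕ} {p : I}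
    (A : Algorithm M K p) (μ : Fin K → ℝ) (k : Fin K) (y : ℝ)
    (h1 : (fun T : ℕ => ∫ h, (pulls h k : ℝ) ∂(historyLaw v A μ T T))
      =O[atTop] fun T : ℕ => (T : ℝ) ^ (1 / 2 : ℝ))
    (h2 : (fun T : ℕ => ∫ h, ((T : ℝ) - pulls h k)
        ∂(historyLaw v A (Function.update μ k y) T T))
      =O[atTop] fun T : ℕ => (T : ℝ) ^ (1 / 2 : ℝ)) :
    ∃ C : ℝ, ∀ᶠ T : ℕ in atTop,
      1 / 2 * Real.log T - C ≤ (μ k - y) ^ 2 / (2 * v) * expectedObs v A μ k T := by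
  obtain ⟨C1, hC1, hb1⟩ := h1.exists_pos
  obtain ⟨C2, hC2, hb2⟩ := h2.exists_pos
  refine ⟨Real.log (4 * (C1 + C2)), ?_⟩
  filter_upwards [hb1.bound, hb2.bound, eventually_gt_atTop 0] with T hT1 hT2 hT0
  have hT : (0 : ℝ) < T := by exact_mod_cast hT0
  have hr : (0 : ℝ) < (T : ℝ) ^ (1 / 2 : ℝ) := Real.rpow_pos_of_pos hT _
  rw [Real.norm_of_nonneg hr.le] at hT1 hT2
  replace hT1 := (le_abs_self _).trans hT1
  replace hT2 := (le_abs_self _).trans hT2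
  set B : Set (Fin T → Round M K p) := {h | (T : ℝ) / 2 ≤ pulls h k} with hBdef
  have hB : MeasurableSet B := measurableSet_le measurable_const (measurable_pulls k)
  have hP : (T : ℝ) / 2 * (historyLaw v A μ T T).real B ≤ C1 * (T : ℝ) ^ (1 / 2 : ℝ) :=
    (mul_meas_ge_le_integral_of_nonneg (Eventually.of_forall fun h => Nat.cast_nonneg _)
      (integrable_pulls v A μ T k) _).trans hT1
  have hQ : (T : ℝ) / 2 * (historyLaw v A (Function.update μ k y) T T).real Bᶜ ≤
      C2 * (T : ℝ) ^ (1 / 2 : ℝ) := by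
    refine le_trans ?_ ((mul_meas_ge_le_integral_of_nonneg
      (Eventually.of_forall fun h => ?_)
      ((integrable_const (T : ℝ)).sub (integrable_pulls v A _ T k)) ((T : ℝ) / 2)).trans hT2)
    · refine mul_le_mul_of_nonneg_left (measureReal_mono fun h hh => ?_) (by positivity)
      simp only [hBdef, Set.mem_compl_iff, Set.mem_ofPred_eq, not_le] at hh ⊢
      simp only [Pi.sub_apply]
      linarith
    · have : (pulls h k : ℝ) ≤ T := by exact_mod_cast pulls_le h k
      simpa using this
  have hBH := exp_neg_expectedObs_le hv A μ k y T hB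
  have hsq : (T : ℝ) ^ (1 / 2 : ℝ) * (T : ℝ) ^ (1 / 2 : ℝ) = T := by
    rw [← Real.rpow_add hT]; norm_num
  set D := (μ k - y) ^ 2 / (2 * v) * expectedObs v A μ k T
  have hmul : Real.exp (-D) * (T : ℝ) ^ (1 / 2 : ℝ) ≤ 4 * (C1 + C2) := by
    refine le_of_mul_le_mul_right ?_ hr
    rw [mul_assoc, hsq]
    nlinarith
  have hlog := Real.log_le_log (by positivity) hmul
  rw [Real.log_mul (Real.exp_ne_zero _) hr.ne', Real.log_exp, Real.log_rpow hT] at hlog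
  linarith

/-! ### Optimal assignments and the cost of suboptimal ones -/

theorem regret_eq_sum (v : ℝ≥0) {M K : ℕ} {p : I} (A : Algorithm M K p) (μ : Fin K → ℝ)
    (mStar : Assignment M K p) (T : ℕ) :
    regret v A μ mStar T =
      ∑ s : Fin T, ∫ h, (meanReward v μ mStar - meanReward v μ (h s).1)
        ∂(historyLaw v A μ T T) := by
  have hm : Measurable (totalReward : Feedback K → ℝ) := by
    unfold totalReward; fun_prop
  unfold regret
  refine Finset.sum_congr rfl fun s _ => ?_
  rw [integral_sub (integrable_const _)
      (integrable_comp_assignment v A μ T T s (meanReward v μ)),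
    integral_historyLaw_apply hm (integrable_totalReward v μ) s]
  simp [meanReward]

/-- The assignment with one player on arm `s` and all others on arm `a`. -/
def splitAssignment {M K : ℕ} {p : I} (hM : 1 ≤ M)
    (hp : (M : ℝ) ≤ -1 / Real.log (1 - (p : ℝ))) {a s : Fin K} (has : a ≠ s) :
    Assignment M K p :=
  ⟨fun k => (if k = a then M - 1 else 0) + (if k = s then 1 else 0), by
    constructor
    · simp only [Finset.sum_add_distrib, Finset.sum_ite_eq', Finset.mem_univ, if_true]
      omega
    · intro k
      refine le_trans ?_ hp
      have : (if k = a then M - 1 else 0) + (if k = s then 1 else 0) ≤ M := by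
        split_ifs <;> grind
      exact_mod_cast this⟩

section Split

variable {M K : ℕ} {p : I} (hM : 1 ≤ M) (hp : (M : ℝ) ≤ -1 / Real.log (1 - (p : ℝ)))
  {a s : Fin K} (has : a ≠ s)

theorem splitAssignment_left : (splitAssignment hM hp has).1 a = M - 1 := by
  simp [splitAssignment, has]

theorem splitAssignment_right : (splitAssignment hM hp has).1 s = 1 := by
  simp [splitAssignment, has.symm]

theorem splitAssignment_of_ne {k : Fin K} (ha : k ≠ a) (hs : k ≠ s) :
    (splitAssignment hM hp has).1 k = 0 := by
  simp [splitAssignment, ha, hs]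

theorem numEmpty_splitAssignment (hM' : 2 ≤ M) :
    numEmpty (splitAssignment hM hp has) = K - 2 := by
  have h : (Finset.univ.filter fun k => (splitAssignment hM hp has).1 k = 0) = {a, s}ᶜ := by
    ext k
    simp only [Finset.mem_filter, Finset.mem_univ, true_and, Finset.mem_compl,
      Finset.mem_insert, Finset.mem_singleton, not_or]
    refine ⟨fun hk => ⟨?_, ?_⟩, fun hk => splitAssignment_of_ne hM hp has hk.1 hk.2⟩
    · rintro rfl
      rw [splitAssignment_left] at hk
      omega
    · rintro rfl
      rw [splitAssignment_right] at hk
      omega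
  rw [numEmpty, h, Finset.card_compl, Finset.card_pair has, Fintype.card_fin]

variable (v : ℝ≥0) {μ : Fin K → ℝ}

/-- Lagrangian bound with the price `μ s * p` for a player. At this price a player on an arm
`k ≠ a` costs at least `μ s - μ k` for every expected observation of that arm. -/
theorem add_sum_le_meanReward_sub (hs0 : 0 ≤ μ s) (m : Assignment M K p) :
    ((μ s * p * (m.1 a : ℝ) - μ a * aloneProb p (m.1 a)) -
        (μ s * p * ((M - 1 : ℕ) : ℝ) - μ a * aloneProb p (M - 1))) +
      ∑ k ∈ Finset.univ.erase a, (μ s - μ k) * aloneProb p (m.1 k) ≤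
    meanReward v μ (splitAssignment hM hp has) - meanReward v μ m := by
  set ms := splitAssignment hM hp has with hms
  have hsum : ∀ m : Assignment M K p, ∑ k, μ s * p * (m.1 k : ℝ) = μ s * p * M := by
    intro m
    rw [← Finset.mul_sum]
    congr 1
    exact_mod_cast m.2.1
  have hdiff : meanReward v μ ms - meanReward v μ m =
      ∑ k, ((μ s * p * (m.1 k : ℝ) - μ k * aloneProb p (m.1 k)) -
        (μ s * p * (ms.1 k : ℝ) - μ k * aloneProb p (ms.1 k))) := by
    simp only [Finset.sum_sub_distrib, hsum, meanReward_eq_sum]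
    ring
  rw [hdiff, ← Finset.add_sum_erase _ _ (Finset.mem_univ a), hms, splitAssignment_left]
  gcongr with k hk
  have hka : k ≠ a := Finset.ne_of_mem_erase hk
  have hle : 0 ≤ μ s * (p * (m.1 k : ℝ) - aloneProb p (m.1 k)) :=
    mul_nonneg hs0 (sub_nonneg.2 (aloneProb_le_mul p _))
  by_cases hks : k = s
  · subst hks
    rw [splitAssignment_right, aloneProb_one]
    push_cast
    linarith
  · rw [splitAssignment_of_ne hM hp has hka hks, aloneProb_zero]
    push_cast
    linarith

variable (hprice : ∀ n ≤ M, n ≠ M - 1 →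
    μ s * p * ((M - 1 : ℕ) : ℝ) - μ a * aloneProb p (M - 1) <
      μ s * p * (n : ℝ) - μ a * aloneProb p n)

include hprice

theorem sum_le_meanReward_sub (hs0 : 0 ≤ μ s) (m : Assignment M K p) :
    ∑ k ∈ Finset.univ.erase a, (μ s - μ k) * aloneProb p (m.1 k) ≤
      meanReward v μ (splitAssignment hM hp has) - meanReward v μ m := by
  refine le_trans ?_ (add_sum_le_meanReward_sub hM hp has v hs0 m)
  have hma : m.1 a ≤ M := by
    have := Finset.single_le_sum (f := m.1) (fun _ _ => Nat.zero_le _) (Finset.mem_univ a)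
    rwa [m.2.1] at this
  by_cases h : m.1 a = M - 1
  · rw [h]; simp
  · linarith [hprice _ hma h]

theorem isUniqueOptimal_splitAssignment (hp0 : 0 < (p : ℝ)) (hp1 : (p : ℝ) < 1)
    (hs0 : 0 ≤ μ s) (hk : ∀ k, k ≠ a → k ≠ s → μ k < μ s) :
    IsUniqueOptimal v μ (splitAssignment hM hp has) := by
  intro m hm
  rw [← sub_pos]
  have hnn : ∀ k ∈ Finset.univ.erase a, 0 ≤ (μ s - μ k) * aloneProb p (m.1 k) := by
    intro k hka
    refine mul_nonneg (sub_nonneg.2 ?_) (aloneProb_nonneg p _)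
    by_cases hks : k = s
    · rw [hks]
    · exact (hk k (Finset.ne_of_mem_erase hka) hks).le
  have hma : m.1 a ≤ M := by
    have := Finset.single_le_sum (f := m.1) (fun _ _ => Nat.zero_le _) (Finset.mem_univ a)
    rwa [m.2.1] at this
  by_cases h : m.1 a = M - 1
  · refine lt_of_lt_of_le ?_ (sum_le_meanReward_sub hM hp has v hprice hs0 m)
    refine Finset.sum_pos' hnn ?_
    by_contra! hcon
    have hzero : ∀ k, k ≠ a ∧ k ≠ s → m.1 k = 0 := by
      rintro k ⟨hka, hks⟩
      by_contra hne
      have := hcon k (Finset.mem_erase.2 ⟨hka, Finset.mem_univ k⟩)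
      have := mul_pos (sub_pos.2 (hk k hka hks)) (aloneProb_pos hp0 hp1 hne)
      linarith
    have hsum := m.2.1
    rw [Fintype.sum_eq_add a s has hzero, h] at hsum
    refine hm (Subtype.ext (funext fun k => ?_))
    by_cases hka : k = a
    · rw [hka, h, splitAssignment_left]
    by_cases hks : k = s
    · rw [hks, splitAssignment_right]; omega
    · rw [hzero k ⟨hka, hks⟩, splitAssignment_of_ne hM hp has hka hks]
  · refine lt_of_lt_of_le ?_ (add_sum_le_meanReward_sub hM hp has v hs0 m)
    have := hprice _ hma h
    have := Finset.sum_nonneg hnn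
    linarith

/-- At the price `μ s * p`, it is best to put `M - 1` players on arm `a`; the regret is then at
least the cost of the observations of all other arms. -/
theorem sum_mul_expectedObs_le_regret (hs0 : 0 ≤ μ s) (A : Algorithm M K p) (T : ℕ) :
    ∑ k ∈ Finset.univ.erase a, (μ s - μ k) * expectedObs v A μ k T ≤
      regret v A μ (splitAssignment hM hp has) T := by
  rw [regret_eq_sum]
  unfold expectedObs
  simp only [Finset.mul_sum]
  rw [Finset.sum_comm]
  refine Finset.sum_le_sum fun t _ => ?_
  simp only [← integral_const_mul]
  have hi : ∀ k, Integrable (fun h => (μ s - μ k) * aloneProb p ((h t).1.1 k))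
      (historyLaw v A μ T T) := fun k =>
    integrable_comp_assignment v A μ T T t fun m => (μ s - μ k) * aloneProb p (m.1 k)
  rw [← integral_finsetSum _ fun k _ => hi k]
  exact integral_mono (integrable_finsetSum _ fun k _ => hi k)
    (integrable_comp_assignment v A μ T T t fun m =>
      meanReward v μ (splitAssignment hM hp has) - meanReward v μ m)
    fun h => sum_le_meanReward_sub hM hp has v hprice hs0 (h t).1

end Split

/-- An arm which is beaten by at most one other arm is among the two best ones. -/
theorem exists_armOfRank_eq {ν : ℕ} {μ : Fin (ν + 2) → ℝ} {a s : Fin (ν + 2)}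
    (hk : ∀ k, k ≠ a → k ≠ s → μ k < μ s) : ∃ i : Fin (ν + 2), ν ≤ i ∧ armOfRank μ i = s := by
  refine ⟨(Tuple.sort μ).symm s, ?_, by simp [armOfRank]⟩
  by_contra! hlt
  set i := (Tuple.sort μ).symm s with hi
  have hs : Tuple.sort μ i = s := by simp [hi]
  have hrank : ∀ j, i < j → Tuple.sort μ j = a := by
    intro j hj
    by_contra hne
    have hle : μ s ≤ μ (Tuple.sort μ j) := by
      have := Tuple.monotone_sort μ hj.le
      simpa [hs] using this
    refine (hk _ hne fun h => hj.ne ?_).not_ge hle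
    rw [hi, ← h, Equiv.symm_apply_apply]
  have h1 := hrank ⟨ν, by omega⟩ (Fin.lt_def.2 hlt)
  have h2 := hrank ⟨ν + 1, by omega⟩ (Fin.lt_def.2 (by simp only; omega))
  have h3 := (Tuple.sort μ).injective (h1.trans h2.symm)
  simp at h3

/-! ### Means for which one player is best placed on the second arm -/

section Price

variable {p : I} {N : ℕ} (hp0 : 0 < (p : ℝ)) (hpN : ((N : ℝ) + 4) * p ≤ 1)

theorem aloneProb_succ_succ_sub (p : I) (n : ℕ) :
    aloneProb p (n + 2) - aloneProb p (n + 1) =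
      p * ((1 - p) ^ n * (1 - ((n : ℝ) + 2) * p)) := by
  simp only [aloneProb, Nat.add_sub_cancel, show n + 2 - 1 = n + 1 by omega]
  push_cast
  ring

include hp0 hpN

/-- If `x` lies strictly between the marginal values of the players `N + 2` and `N + 3` of an arm
with mean `1`, divided by `p`, then at the price `x * p` it is best to put `N + 2` players there. -/
theorem price_lt {x : ℝ} (hlow : (1 - (p : ℝ)) ^ (N + 1) * (1 - ((N : ℝ) + 3) * p) < x)
    (hhigh : x < (1 - (p : ℝ)) ^ N * (1 - ((N : ℝ) + 2) * p)) {n : ℕ} (hn : n ≤ N + 3)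
    (hne : n ≠ N + 2) :
    x * p * ((N + 2 : ℕ) : ℝ) - aloneProb p (N + 2) < x * p * n - aloneProb p n := by
  have hN : (0 : ℝ) ≤ N := N.cast_nonneg
  have hq0 : 0 ≤ 1 - (p : ℝ) := by nlinarith
  have hq1 : 1 - (p : ℝ) ≤ 1 := by linarith
  have hU1 : (1 - (p : ℝ)) ^ N * (1 - ((N : ℝ) + 2) * p) ≤ 1 :=
    mul_le_one₀ (pow_le_one₀ hq0 hq1) (by nlinarith) (by nlinarith)
  have hstep : ∀ n ≤ N + 1, x * p < aloneProb p (n + 1) - aloneProb p n := by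
    rintro (_ | n) hn
    · rw [zero_add, aloneProb_one, aloneProb_zero]
      nlinarith
    · have hn' : (n : ℝ) ≤ N := by exact_mod_cast Nat.le_of_succ_le_succ hn
      have hle : (1 - (p : ℝ)) ^ N * (1 - ((N : ℝ) + 2) * p) ≤
          (1 - (p : ℝ)) ^ n * (1 - ((n : ℝ) + 2) * p) := by
        refine mul_le_mul (pow_le_pow_of_le_one hq0 hq1 (Nat.le_of_succ_le_succ hn)) ?_ ?_
          (pow_nonneg hq0 _)
        · nlinarith
        · nlinarith
      rw [aloneProb_succ_succ_sub, mul_comm x]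
      exact mul_lt_mul_of_pos_left (hhigh.trans_le hle) hp0
  have hmono : ∀ d ≤ N + 1, ∀ n, n + (d + 1) = N + 2 →
      x * p * ((N + 2 : ℕ) : ℝ) - aloneProb p (N + 2) < x * p * n - aloneProb p n := by
    intro d
    induction d with
    | zero =>
      intro _ n hn
      obtain rfl : n = N + 1 := by omega
      have := hstep (N + 1) le_rfl
      push_cast
      linarith
    | succ d ih =>
      intro hd n hn
      have h1 := ih (by omega) (n + 1) (by omega)
      have h2 := hstep n (by omega)
      push_cast at h1 ⊢
      linarith
  obtain hlt | rfl : n < N + 2 ∨ n = N + 3 := by omega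
  · exact hmono (N + 1 - n) (by omega) n (by omega)
  · have h := aloneProb_succ_succ_sub p (N + 1)
    have h' := mul_lt_mul_of_pos_left hlow hp0
    push_cast at h ⊢
    rw [show (N : ℝ) + 1 + 2 = N + 3 by ring] at h
    rw [← h] at h'
    linarith

/-- The interval of admissible `x` in `price_lt` is longer than `p / 4`. -/
theorem div_four_lt_sub :
    (p : ℝ) / 4 < (1 - (p : ℝ)) ^ N * (1 - ((N : ℝ) + 2) * p) -
      (1 - (p : ℝ)) ^ (N + 1) * (1 - ((N : ℝ) + 3) * p) := by
  have hN : (0 : ℝ) ≤ N := N.cast_nonneg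
  have hq : 0 < 1 - (p : ℝ) := by nlinarith
  have heq : (1 - (p : ℝ)) ^ N * (1 - ((N : ℝ) + 2) * p) -
      (1 - (p : ℝ)) ^ (N + 1) * (1 - ((N : ℝ) + 3) * p) =
        (1 - (p : ℝ)) ^ N * (p * (2 - ((N : ℝ) + 3) * p)) := by ring
  have hpow : 1 / 4 < (1 - (p : ℝ)) ^ N := by
    -- `1 ≤ (1 - p) * exp (1 / (N + 3))`, so the power is at least `exp (-1)`
    have h1 : 1 ≤ (1 - (p : ℝ)) * Real.exp (1 / ((N : ℝ) + 3)) := by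
      have h2 := Real.add_one_le_exp (1 / ((N : ℝ) + 3))
      have h3 : 1 ≤ (1 - (p : ℝ)) * (1 / ((N : ℝ) + 3) + 1) := by
        rw [div_add_one (by positivity), mul_div_assoc', le_div_iff₀ (by positivity)]
        nlinarith
      exact h3.trans (mul_le_mul_of_nonneg_left h2 hq.le)
    have h4 : 1 ≤ (1 - (p : ℝ)) ^ N * Real.exp (N * (1 / ((N : ℝ) + 3))) := by
      have := one_le_pow₀ h1 (n := N)
      rwa [mul_pow, ← Real.exp_nat_mul] at this
    have h5 : Real.exp (N * (1 / ((N : ℝ) + 3))) ≤ Real.exp 1 := by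
      refine Real.exp_le_exp.2 ?_
      rw [mul_one_div, div_le_one (by positivity)]
      linarith
    have h6 := Real.exp_one_lt_d9
    have h7 : 0 < (1 - (p : ℝ)) ^ N := pow_pos hq N
    nlinarith
  rw [heq]
  nlinarith [mul_pos hp0 (show 0 < 2 - ((N : ℝ) + 3) * p by nlinarith)]

end Price

/-- For `p ≤ 1 / (M + 1)` every arm may receive all `M` players. -/
theorem natCast_le_neg_one_div_log {p : I} {M : ℕ} (hp0 : 0 < (p : ℝ))
    (hpM : ((M : ℝ) + 1) * p ≤ 1) (hM : 0 < M) : (M : ℝ) ≤ -1 / Real.log (1 - (p : ℝ)) := by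
  have hM' : (0 : ℝ) < M := by exact_mod_cast hM
  have hq : 0 < 1 - (p : ℝ) := by nlinarith
  have hlog : Real.log (1 - (p : ℝ)) < 0 := Real.log_neg hq (by linarith)
  have h := Real.one_sub_inv_le_log_of_pos hq
  have h2 : (1 - (p : ℝ))⁻¹ ≤ 1 + 1 / M := by
    rw [inv_le_comm₀ hq (by positivity)]
    rw [one_add_div hM'.ne', inv_div, div_le_iff₀ (by positivity)]
    nlinarith
  rw [le_div_iff_of_neg hlog]
  have h3 : (M : ℝ) * (1 / M) = 1 := by field_simp
  nlinarith

/-- The instance with best mean `1`, second best mean `b` and the gaps `Δ` below `b`. -/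
noncomputable def gapMeans {ν : ℕ} (b : ℝ) (Δ : Fin ν → ℝ) : Fin (ν + 2) → ℝ :=
  Fin.snoc (α := fun _ => ℝ) (Fin.snoc (α := fun _ => ℝ) (fun j => b - Δ j) b) 1

section GapMeans

variable {ν : ℕ} (b : ℝ) (Δ : Fin ν → ℝ)

theorem gapMeans_last : gapMeans b Δ (Fin.last (ν + 1)) = 1 := by simp [gapMeans]

theorem gapMeans_second : gapMeans b Δ (Fin.last ν).castSucc = b := by simp [gapMeans]

theorem gapMeans_castSucc (j : Fin ν) : gapMeans b Δ j.castSucc.castSucc = b - Δ j := by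
  simp [gapMeans]

variable {b Δ}

theorem monotone_gapMeans (hb : b ≤ 1) (hΔ : Antitone Δ) (h0 : ∀ j, 0 < Δ j) :
    Monotone (gapMeans b Δ) := by
  intro i j hij
  induction j using Fin.lastCases with
  | last =>
    rw [gapMeans_last]
    induction i using Fin.lastCases with
    | last => rw [gapMeans_last]
    | cast i =>
      induction i using Fin.lastCases with
      | last => rwa [gapMeans_second]
      | cast i => rw [gapMeans_castSucc]; linarith [h0 i]
  | cast j =>
    induction i using Fin.lastCases with
    | last => exact absurd hij (Fin.castSucc_lt_last j).not_ge
    | cast i =>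
      rw [Fin.castSucc_le_castSucc_iff] at hij
      induction j using Fin.lastCases with
      | last =>
        rw [gapMeans_second]
        induction i using Fin.lastCases with
        | last => rw [gapMeans_second]
        | cast i => rw [gapMeans_castSucc]; linarith [h0 i]
      | cast j =>
        induction i using Fin.lastCases with
        | last => exact absurd hij (Fin.castSucc_lt_last j).not_ge
        | cast i =>
          rw [gapMeans_castSucc, gapMeans_castSucc]
          linarith [hΔ (Fin.castSucc_le_castSucc_iff.1 hij)]

theorem armOfRank_gapMeans (hb : b ≤ 1) (hΔ : Antitone Δ) (h0 : ∀ j, 0 < Δ j)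
    (i : Fin (ν + 2)) : armOfRank (gapMeans b Δ) i = i := by
  rw [armOfRank, Tuple.sort_eq_refl_iff_monotone.2 (monotone_gapMeans hb hΔ h0)]
  rfl

end GapMeans

/-! ### Optimality and regret for the instances with prescribed gaps -/

section GapMeansOptimal

variable {M ν : ℕ} {p : I} {b : ℝ} {Δ : Fin ν → ℝ}

theorem gapMeans_mem_Icc (hb0 : 0 ≤ b) (hb1 : b ≤ 1) (h0 : ∀ j, 0 < Δ j)
    (hb : ∀ j, 0 ≤ b - Δ j) (k : Fin (ν + 2)) : gapMeans b Δ k ∈ Set.Icc (0 : ℝ) 1 := by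
  induction k using Fin.lastCases with
  | last => rw [gapMeans_last]; simp
  | cast k =>
    induction k using Fin.lastCases with
    | last => rw [gapMeans_second]; exact ⟨hb0, hb1⟩
    | cast k => rw [gapMeans_castSucc]; exact ⟨hb k, by linarith [h0 k]⟩

theorem gapMeans_lt_second (h0 : ∀ j, 0 < Δ j) {k : Fin (ν + 2)} (ha : k ≠ Fin.last (ν + 1))
    (hs : k ≠ (Fin.last ν).castSucc) :
    gapMeans b Δ k < gapMeans b Δ (Fin.last ν).castSucc := by
  rw [gapMeans_second]
  induction k using Fin.lastCases with
  | last => exact absurd rfl ha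
  | cast k =>
    induction k using Fin.lastCases with
    | last => exact absurd rfl hs
    | cast k => rw [gapMeans_castSucc]; linarith [h0 k]

theorem last_ne_castSucc {n : ℕ} (i : Fin n) : Fin.last n ≠ i.castSucc :=
  (Fin.castSucc_lt_last i).ne'

theorem isUniqueOptimal_gapMeans (v : ℝ≥0) (hM : 1 ≤ M)
    (hp : (M : ℝ) ≤ -1 / Real.log (1 - (p : ℝ))) (hp0 : 0 < (p : ℝ)) (hp1 : (p : ℝ) < 1)
    (hb0 : 0 ≤ b) (h0 : ∀ j, 0 < Δ j)
    (hprice : ∀ n ≤ M, n ≠ M - 1 →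
      b * p * ((M - 1 : ℕ) : ℝ) - aloneProb p (M - 1) < b * p * (n : ℝ) - aloneProb p n) :
    IsUniqueOptimal v (gapMeans b Δ)
      (splitAssignment hM hp (last_ne_castSucc (Fin.last ν))) := by
  refine isUniqueOptimal_splitAssignment hM hp _ v ?_ hp0 hp1 ?_
    fun k => gapMeans_lt_second h0
  · rw [gapMeans_last, gapMeans_second]
    simpa using hprice
  · rwa [gapMeans_second]

/-- Raising the mean of the `j`-th worst arm from `b - Δ j` to `b + Δ j` makes it the second best
arm, so that a consistent algorithm must observe it often enough to exclude this. -/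
theorem exists_log_sub_le_expectedObs_gapMeans {v : ℝ≥0} (hv : v ≠ 0)
    (hM : 2 ≤ M) (hp : (M : ℝ) ≤ -1 / Real.log (1 - (p : ℝ))) (hp0 : 0 < (p : ℝ))
    (hp1 : (p : ℝ) < 1) {A : Algorithm M (ν + 2) p} (hA : Consistent v A)
    (hΔ : Antitone Δ) (h0 : ∀ j, 0 < Δ j) (hb : ∀ j, 0 ≤ b - Δ j)
    (hb0 : 0 ≤ b) (hb1 : b ≤ 1) (j : Fin ν) (hj1 : b + Δ j ≤ 1)
    (hprice : ∀ x, x = b ∨ x = b + Δ j → ∀ n ≤ M, n ≠ M - 1 →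
      x * p * ((M - 1 : ℕ) : ℝ) - aloneProb p (M - 1) < x * p * (n : ℝ) - aloneProb p n) :
    ∃ C : ℝ, ∀ᶠ T : ℕ in atTop,
      1 / 2 * Real.log T - C ≤
        2 * Δ j ^ 2 / v * expectedObs v A (gapMeans b Δ) j.castSucc.castSucc T := by
  have hM1 : 1 ≤ M := by omega
  set a : Fin (ν + 2) := Fin.last (ν + 1) with ha
  set k : Fin (ν + 2) := j.castSucc.castSucc with hk
  have hak : a ≠ k := last_ne_castSucc _
  set μ' := Function.update (gapMeans b Δ) k (b + Δ j) with hμ'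
  have hμ'k : μ' k = b + Δ j := by simp [hμ']
  have hμ'a : μ' a = 1 := by rw [hμ', Function.update_of_ne hak, ha, gapMeans_last]
  have hlt : ∀ i, i ≠ a → i ≠ k → μ' i < μ' k := by
    intro i hia hik
    rw [hμ'k, hμ', Function.update_of_ne hik]
    have : gapMeans b Δ i ≤ b := by
      by_cases his : i = (Fin.last ν).castSucc
      · rw [his, gapMeans_second]
      · exact (gapMeans_lt_second h0 hia his).le.trans_eq (gapMeans_second b Δ)
    linarith [h0 j]
  have hIcc : ∀ i, μ' i ∈ Set.Icc (0 : ℝ) 1 := by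
    intro i
    by_cases hik : i = k
    · rw [hik, hμ'k]; exact ⟨by linarith [h0 j], hj1⟩
    · rw [hμ', Function.update_of_ne hik]; exact gapMeans_mem_Icc hb0 hb1 h0 hb i
  have hopt : IsUniqueOptimal v μ' (splitAssignment hM1 hp hak) := by
    refine isUniqueOptimal_splitAssignment hM1 hp hak v ?_ hp0 hp1 ?_ hlt
    · rw [hμ'a, hμ'k]
      simpa using hprice (b + Δ j) (Or.inr rfl)
    · rw [hμ'k]; linarith [h0 j]
  obtain ⟨i, hi, hik⟩ := exists_armOfRank_eq hlt
  have hoften := (hA μ' hIcc _ hopt (1 / 2) (by norm_num) i).1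
    (by rw [numEmpty_splitAssignment hM1 hp hak hM]; omega)
  have hrarely := (hA _ (gapMeans_mem_Icc hb0 hb1 h0 hb) _
    (isUniqueOptimal_gapMeans v hM1 hp hp0 hp1 hb0 h0 (hprice b (Or.inl rfl)))
    (1 / 2) (by norm_num) k).2
    (by rw [numEmpty_splitAssignment hM1 hp _ hM]; simp [hk])
  rw [armOfRank_gapMeans hb1 hΔ h0] at hrarely
  rw [hik] at hoften
  obtain ⟨C, hC⟩ := exists_log_sub_le_expectedObs hv A (gapMeans b Δ) k (b + Δ j) hrarely hoften
  refine ⟨C, hC.mono fun T hT => hT.trans_eq ?_⟩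
  rw [hk, gapMeans_castSucc]
  ring

theorem sum_gap_mul_expectedObs_le_regret (v : ℝ≥0) (hM : 1 ≤ M)
    (hp : (M : ℝ) ≤ -1 / Real.log (1 - (p : ℝ))) (hb0 : 0 ≤ b)
    (hprice : ∀ n ≤ M, n ≠ M - 1 →
      b * p * ((M - 1 : ℕ) : ℝ) - aloneProb p (M - 1) < b * p * (n : ℝ) - aloneProb p n)
    (A : Algorithm M (ν + 2) p) (T : ℕ) :
    ∑ j, Δ j * expectedObs v A (gapMeans b Δ) j.castSucc.castSucc T ≤
      regret v A (gapMeans b Δ) (splitAssignment hM hp (last_ne_castSucc (Fin.last ν))) T := by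
  refine le_trans (le_of_eq ?_) (sum_mul_expectedObs_le_regret hM hp
    (last_ne_castSucc (Fin.last ν)) v ?_ ?_ A T)
  · rw [Finset.sum_erase_eq_sub (Finset.mem_univ _), Fin.sum_univ_castSucc, Fin.sum_univ_castSucc]
    simp [gapMeans_second, gapMeans_castSucc]
  · rw [gapMeans_last, gapMeans_second]
    simpa using hprice
  · rwa [gapMeans_second]

end GapMeansOptimal

/-! ### The lower bound -/

/-- A function of `T` above a sum of multiples `w j` of `log T / 2 - C j` is asymptotically at
least `(∑ j, w j / 2) * log T`. -/
theorem le_liminf_div_log {ι : Type*} [Fintype ι] {f : ℕ → ℝ} {w C : ι → ℝ}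
    (h : ∀ᶠ T : ℕ in atTop, ∑ j, w j * (1 / 2 * Real.log T - C j) ≤ f T) :
    ((∑ j, w j / 2 : ℝ) : EReal) ≤
      liminf (fun T : ℕ => ((f T / Real.log (T : ℝ) : ℝ) : EReal)) atTop := by
  have hlog : Tendsto (fun T : ℕ => Real.log (T : ℝ)) atTop atTop :=
    Real.tendsto_log_atTop.comp tendsto_natCast_atTop_atTop
  have hlim : Tendsto (fun T : ℕ => ∑ j, w j / 2 - (∑ j, w j * C j) / Real.log (T : ℝ)) atTop
      (nhds (∑ j, w j / 2)) := by
    simpa using (tendsto_const_nhds (x := ∑ j, w j / 2)).sub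
      ((tendsto_const_nhds (x := ∑ j, w j * C j)).div_atTop hlog)
  have hlim' := (continuous_coe_real_ereal.tendsto _).comp hlim
  rw [← hlim'.liminf_eq]
  refine liminf_le_liminf ?_
  filter_upwards [h, hlog.eventually_gt_atTop 0] with T hT hpos
  refine EReal.coe_le_coe_iff.2 ?_
  rw [le_div_iff₀ hpos, sub_mul, div_mul_cancel₀ _ hpos.ne', Finset.sum_mul,
    ← Finset.sum_sub_distrib]
  refine le_trans (le_of_eq (Finset.sum_congr rfl fun j _ => ?_)) hT
  ring

/-- The lower bound, with the constant `1 / 4`, for `M = N + 3` players and gaps at most `p / 8`. -/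
theorem exists_le_liminf_regret {v : ℝ≥0} (hv : v ≠ 0) {N ν : ℕ} {p : I} {Δ : Fin ν → ℝ}
    {A : Algorithm (N + 3) (ν + 2) p} (hp0 : 0 < (p : ℝ)) (hpN : ((N : ℝ) + 4) * p ≤ 1)
    (hΔ : Antitone Δ) (h0 : ∀ j, 0 < Δ j) (h8 : ∀ j, Δ j ≤ p / 8) (hA : Consistent v A) :
    ∃ (μ : Fin (ν + 2) → ℝ) (mStar : Assignment (N + 3) (ν + 2) p),
      (∀ k, μ k ∈ Set.Icc (0 : ℝ) 1) ∧ IsUniqueOptimal v μ mStar ∧ numEmpty mStar = ν ∧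
      (∀ j : Fin ν, μ (armOfRank μ ⟨ν, by omega⟩) - μ (armOfRank μ (Fin.castAdd 2 j)) = Δ j) ∧
      ((∑ j, 1 / 4 * (v : ℝ) / Δ j : ℝ) : EReal) ≤
        liminf (fun T : ℕ => ((regret v A μ mStar T / Real.log (T : ℝ) : ℝ) : EReal)) atTop := by
  have hN : (0 : ℝ) ≤ N := N.cast_nonneg
  have hp1 : (p : ℝ) < 1 := by nlinarith
  have hq0 : 0 ≤ 1 - (p : ℝ) := by linarith
  have hwidth := div_four_lt_sub hp0 hpN
  have hprice := fun x => @price_lt p N hp0 hpN x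
  have hL0 : 0 ≤ (1 - (p : ℝ)) ^ (N + 1) * (1 - ((N : ℝ) + 3) * p) :=
    mul_nonneg (pow_nonneg hq0 _) (by nlinarith)
  have hU1 : (1 - (p : ℝ)) ^ N * (1 - ((N : ℝ) + 2) * p) ≤ 1 :=
    mul_le_one₀ (pow_le_one₀ hq0 (by linarith)) (by nlinarith) (by nlinarith)
  generalize (1 - (p : ℝ)) ^ (N + 1) * (1 - ((N : ℝ) + 3) * p) = L at *
  generalize (1 - (p : ℝ)) ^ N * (1 - ((N : ℝ) + 2) * p) = U at *
  -- The second best mean is the midpoint of the interval of admissible prices: its half-width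
  -- exceeds `p / 8`, so `b + Δ j` is admissible as well and `b - Δ j` is nonnegative.
  obtain ⟨b, hb⟩ : ∃ b, b = (L + U) / 2 := ⟨_, rfl⟩
  have hbΔ : ∀ j, 0 ≤ b - Δ j := fun j => by linarith [h8 j]
  have hbp : ∀ x, L < x → x < U → ∀ n ≤ N + 3, n ≠ N + 3 - 1 →
      x * p * ((N + 3 - 1 : ℕ) : ℝ) - aloneProb p (N + 3 - 1) <
        x * p * (n : ℝ) - aloneProb p n := fun x h1 h2 n hn hne => hprice x h1 h2 hn hne
  have hb0 : 0 ≤ b := by linarith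
  have hb1 : b ≤ 1 := by linarith
  have hbprice := hbp b (by linarith) (by linarith)
  have hp : ((N + 3 : ℕ) : ℝ) ≤ -1 / Real.log (1 - (p : ℝ)) :=
    natCast_le_neg_one_div_log hp0 (by push_cast; linarith) (by omega)
  refine ⟨gapMeans b Δ, splitAssignment (by omega) hp (last_ne_castSucc (Fin.last ν)),
    gapMeans_mem_Icc hb0 hb1 h0 hbΔ,
    isUniqueOptimal_gapMeans v (by omega) hp hp0 hp1 hb0 h0 hbprice,
    numEmpty_splitAssignment _ hp _ (by omega), fun j => ?_, ?_⟩
  · rw [armOfRank_gapMeans hb1 hΔ h0, armOfRank_gapMeans hb1 hΔ h0]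
    exact (congrArg₂ (· - ·) (gapMeans_second b Δ) (gapMeans_castSucc b Δ j)).trans (by ring)
  · have hobs : ∀ j, ∃ C : ℝ, ∀ᶠ T : ℕ in atTop, 1 / 2 * Real.log T - C ≤
        2 * Δ j ^ 2 / v * expectedObs v A (gapMeans b Δ) j.castSucc.castSucc T := by
      intro j
      refine exists_log_sub_le_expectedObs_gapMeans hv (by omega) hp hp0 hp1 hA hΔ h0 hbΔ hb0 hb1
        j (by linarith [h8 j]) ?_
      rintro x (rfl | rfl)
      · exact hbprice
      · exact hbp _ (by linarith [h0 j]) (by linarith [h8 j])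
    choose C hC using hobs
    have hv' : 0 < (v : ℝ) := by exact_mod_cast pos_iff_ne_zero.2 hv
    have hsum : ∑ j, 1 / 4 * (v : ℝ) / Δ j = ∑ j, (v : ℝ) / (2 * Δ j) / 2 :=
      Finset.sum_congr rfl fun j _ => by have := (h0 j).ne'; field_simp; norm_num
    rw [hsum]
    refine le_liminf_div_log (C := C) ?_
    filter_upwards [eventually_all.2 hC] with T hT
    refine le_trans (Finset.sum_le_sum fun j _ => ?_)
      (sum_gap_mul_expectedObs_le_regret v (by omega) hp hb0 hbprice A T)
    have hj := h0 j
    refine (mul_le_mul_of_nonneg_left (hT j) (by positivity)).trans_eq ?_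
    field_simp

end AsyncBandit

theorem mainTheorem3 :
    ∃ c : ℝ, 0 < c ∧
      ∀ (v : ℝ≥0) (M ν : ℕ) (p : I) (Δ : Fin ν → ℝ) (A : AsyncBandit.Algorithm M (ν + 2) p),
        v ≠ 0 → 5 ≤ M → 0 < ν → 0 < (p : ℝ) → (p : ℝ) ≤ 1 / ((M : ℝ) + 1) →
        Antitone Δ → (∀ j, 0 < Δ j ∧ Δ j ≤ (p : ℝ) / (8 * ((M : ℝ) - 4))) →
        AsyncBandit.Consistent v A →
        ∃ (μ : Fin (ν + 2) → ℝ) (mStar : AsyncBandit.Assignment M (ν + 2) p),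
          (∀ k, μ k ∈ Set.Icc (0 : ℝ) 1) ∧
          AsyncBandit.IsUniqueOptimal v μ mStar ∧
          AsyncBandit.numEmpty mStar = ν ∧
          (∀ j : Fin ν,
            μ (AsyncBandit.armOfRank μ ⟨ν, by omega⟩) -
              μ (AsyncBandit.armOfRank μ (Fin.castAdd 2 j)) = Δ j) ∧
          ((∑ j, c * (v : ℝ) / Δ j : ℝ) : EReal) ≤
            liminf (fun T : ℕ =>
              ((AsyncBandit.regret v A μ mStar T / Real.log (T : ℝ) : ℝ) : EReal)) atTop := by
  refine ⟨1 / 4, by norm_num, fun v M ν p Δ A hv hM _ hp0 hpM hΔ hgap hA => ?_⟩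
  obtain ⟨N, rfl⟩ : ∃ N, M = N + 3 := ⟨M - 3, by omega⟩
  have hM' : (2 : ℝ) ≤ N := by exact_mod_cast (by omega : 2 ≤ N)
  push_cast at hpM hgap
  refine AsyncBandit.exists_le_liminf_regret hv hp0 ?_ hΔ (fun j => (hgap j).1)
    (fun j => (hgap j).2.trans ?_) hA
  · rw [le_div_iff₀ (by linarith)] at hpM
    linarith
  · exact div_le_div_of_nonneg_left hp0.le (by norm_num) (by linarith)
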